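/- Let $\mathfrak C=\{0,1\}^n$ be the vertex set of the $n$-dimensional hypercube, where $u,v$ are joined by an edge if $u\oplus v=e_i$ for some $i\in[n]$. An orientation of the edges is a *unique sink orientation* (USO) if every face of the cube (including the cube itself and the vertices) has exactly one sink; the *outmap* of an orientation is the function $s\colon\mathfrak C\to\{0,1\}^n$ with $s(u)_i=1$ if and only if the edge $\{u,u\oplus e_i\}$ is oriented away from $u$. Consider two search problems in which an algorithm adaptively queries an oracle for a function $s\colon\mathfrak C\to\{0,1\}^n$, each query revealing the value $s(u)$ at one vertex $u$: * **Sink-USO**: $s$ is promised to be the outmap of a USO; query the vertex $u$ with $s(u)=0^n$. * **Sink-or-Clash**: $s$ is arbitrary; query either a vertex $u$ with $s(u)=0^n$, or two distinct vertices $u,v$ with $(s(u)\oplus s(v))\wedge(u\oplus v)=0^n$. Let $q(n)$ and $t(n)$ be the minimum, over deterministic algorithms, of the maximum, over the admissible inputs $s$, of the number of queries made until Sink-USO, respectively Sink-or-Clash, is solved. Let $\tilde q(n)$ and $\tilde t(n)$ be the corresponding optimal worst-case expected numbers of queries for randomized algorithms, i.e. for probability distributions over deterministic algorithms. Then, for every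 $n\ge 0$, $$q(n)\le t(n)\qquad\text{and}\qquad \tilde q(n)\le\tilde t(n),$$ and moreover $$t(n)\in\Omega\!\left(\frac{n^2}{\log n}\right)\qquad(n\to\infty).$$ -/

import Mathlib

open Filter Asymptotics MeasureTheory
open scoped ENNReal

namespace SinkOrClash

/-! ### The hypercube and its orientations -/

/-- Vertices of the `n`-dimensional hypercube: bitstrings of length `n`. -/
abbrev Vertex (n : ℕ) : Type := Fin n → Bool

/-- The vertex `u ⊕ e_i`, the neighbour of `u` along dimension `i`. -/
def neighbor {n : ℕ} (u : Vertex n) (i : Fin n) : Vertex n := Function.update u i (!(u i))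

/-- `u` and `v` are joined by an edge of the hypercube. -/
def IsEdge {n : ℕ} (u v : Vertex n) : Prop := ∃ i : Fin n, v = neighbor u i

/-- An orientation of the edges of the hypercube: `dir u v = true` means that the edge `{u, v}` is
oriented from `u` to `v`, and then `dir v u = false`. (Values at non-edges are never used.) -/
structure Orientation (n : ℕ) where
  dir : Vertex n → Vertex n → Bool
  dir_swap : ∀ u v, IsEdge u v → dir v u = !(dir u v)

/-- The (vertex set of the) face that contains `u` and is spanned by the dimensions in `I`. -/
def face {n : ℕ} (u : Vertex n) (I : Set (Fin n)) : Set (Vertex n) :=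
  {v | ∀ i, i ∉ I → v i = u i}

/-- `v` is a sink of the directed subgraph induced by `F`: it lies in `F` and has no outgoing edge
that stays in `F`. -/
def Orientation.IsSinkOf {n : ℕ} (ψ : Orientation n) (F : Set (Vertex n)) (v : Vertex n) : Prop :=
  v ∈ F ∧ ∀ w ∈ F, IsEdge v w → ψ.dir v w = false

/-- Unique sink orientation: every face has exactly one sink. -/
def Orientation.IsUSO {n : ℕ} (ψ : Orientation n) : Prop :=
  ∀ (u : Vertex n) (I : Set (Fin n)), ∃! v, ψ.IsSinkOf (face u I) v

/-- Outmaps: arbitrary functions from the vertices to bitstrings of length `n`. -/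
abbrev Outmap (n : ℕ) : Type := Vertex n → (Fin n → Bool)

/-- The outmap of an orientation. -/
def Orientation.outmap {n : ℕ} (ψ : Orientation n) : Outmap n :=
  fun u i => ψ.dir u (neighbor u i)

/-- The function `s` is the outmap of a unique sink orientation. -/
def RepresentsUSO {n : ℕ} (s : Outmap n) : Prop :=
  ∃ ψ : Orientation n, ψ.IsUSO ∧ s = ψ.outmap

/-- `s u = 0^n`. -/
def IsSink {n : ℕ} (s : Outmap n) (u : Vertex n) : Prop := ∀ i, s u i = false

/-- Distinct vertices `u`, `v` with `(s u ⊕ s v) ∧ (u ⊕ v) = 0^n`. -/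
def IsClash {n : ℕ} (s : Outmap n) (u v : Vertex n) : Prop :=
  u ≠ v ∧ ∀ i, ((s u i ^^ s v i) && (u i ^^ v i)) = false

/-! ### Query algorithms -/

/-- What an algorithm has seen so far: queried vertices with their answers, latest first. -/
abbrev History (n : ℕ) : Type := List (Vertex n × (Fin n → Bool))

/-- A deterministic query algorithm chooses the next vertex to query from the history. -/
abbrev DetAlgorithm (n : ℕ) : Type := History n → Vertex n

/-- The history after `k` queries of `A` to the oracle `s`. -/
def transcript {n : ℕ} (A : DetAlgorithm n) (s : Outmap n) : ℕ → History n
  | 0 => []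
  | k + 1 => (A (transcript A s k), s (A (transcript A s k))) :: transcript A s k

/-- The set of vertices that are among the first `k` queries of `A` to `s`. -/
def queried {n : ℕ} (A : DetAlgorithm n) (s : Outmap n) (k : ℕ) : Set (Vertex n) :=
  {v | ∃ p ∈ transcript A s k, p.1 = v}

/-- Solutions of Sink-USO, in terms of the set `Q` of queried vertices: the sink is queried. -/
def SolvesSink {n : ℕ} (s : Outmap n) (Q : Set (Vertex n)) : Prop := ∃ u ∈ Q, IsSink s u

/-- Solutions of Sink-or-Clash: a sink is queried, or both vertices of a clash are queried. -/
def SolvesSinkOrClash {n : ℕ} (s : Outmap n) (Q : Set (Vertex n)) : Prop :=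
  (∃ u ∈ Q, IsSink s u) ∨ ∃ u ∈ Q, ∃ v ∈ Q, IsClash s u v

/-- The number of queries that `A` makes on `s` until Sink-USO is solved (`⊤` if never). -/
noncomputable def costSink {n : ℕ} (A : DetAlgorithm n) (s : Outmap n) : ℕ∞ :=
  ⨅ (k : ℕ) (_ : SolvesSink s (queried A s k)), (k : ℕ∞)

/-- The number of queries that `A` makes on `s` until Sink-or-Clash is solved (`⊤` if never). -/
noncomputable def costSinkOrClash {n : ℕ} (A : DetAlgorithm n) (s : Outmap n) : ℕ∞ :=
  ⨅ (k : ℕ) (_ : SolvesSinkOrClash s (queried A s k)), (k : ℕ∞)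

/-- `q(n)`: deterministic query complexity of Sink-USO, where the inputs are the outmaps of USOs. -/
noncomputable def q (n : ℕ) : ℕ∞ :=
  ⨅ A : DetAlgorithm n, ⨆ (s : Outmap n) (_ : RepresentsUSO s), costSink A s

/-- `t(n)`: deterministic query complexity of Sink-or-Clash, where the inputs are all outmaps. -/
noncomputable def t (n : ℕ) : ℕ∞ :=
  ⨅ A : DetAlgorithm n, ⨆ s : Outmap n, costSinkOrClash A s

/-- A randomized algorithm is a probability distribution on deterministic algorithms, for the
product sigma-algebra of the function space `History n → Vertex n`. -/
abbrev RandAlgorithm (n : ℕ) : Type := ProbabilityMeasure (DetAlgorithm n)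

/-- Randomized query complexity of Sink-USO: the optimal worst-case expected number of queries. -/
noncomputable def qRand (n : ℕ) : ℝ≥0∞ :=
  ⨅ P : RandAlgorithm n, ⨆ (s : Outmap n) (_ : RepresentsUSO s),
    ∫⁻ A, (costSink A s : ℝ≥0∞) ∂(P : Measure (DetAlgorithm n))

/-- Randomized query complexity of Sink-or-Clash: the optimal worst-case expected number of
queries. -/
noncomputable def tRand (n : ℕ) : ℝ≥0∞ :=
  ⨅ P : RandAlgorithm n, ⨆ s : Outmap n,
    ∫⁻ A, (costSinkOrClash A s : ℝ≥0∞) ∂(P : Measure (DetAlgorithm n))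

/-! ### The complexities are well defined -/

theorem measurableSet_transcript {n : ℕ} (s : Outmap n) (k : ℕ) (h : History n) :
    MeasurableSet {A : DetAlgorithm n | transcript A s k = h} := by
  induction k generalizing h with
  | zero => simp [transcript]
  | succ k ih =>
    cases h with
    | nil => simp [transcript]
    | cons p h =>
      have : {A : DetAlgorithm n | transcript A s (k + 1) = p :: h} =
          {A | transcript A s k = h} ∩ {A | A h = p.1 ∧ s p.1 = p.2} := by
        ext A
        simp only [transcript, List.cons.injEq, Set.mem_ofPred_eq, Set.mem_inter_iff]
        constructor
        · rintro ⟨rfl, rfl⟩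
          simp
        · rintro ⟨rfl, h1, h2⟩
          exact ⟨Prod.ext h1 (by rw [h1]; exact h2), rfl⟩
      rw [this]
      refine (ih h).inter ?_
      have hm : Measurable fun A : DetAlgorithm n => A h := measurable_pi_apply h
      exact hm (Set.toFinite {v | v = p.1 ∧ s p.1 = p.2}).measurableSet

theorem measurableSet_queried {n : ℕ} (s : Outmap n) (S : Set (Vertex n) → Prop) (k : ℕ) :
    MeasurableSet {A : DetAlgorithm n | S (queried A s k)} := by
  have : {A : DetAlgorithm n | S (queried A s k)} =
      ⋃ (h : History n) (_ : S {v | ∃ p ∈ h, p.1 = v}), {A | transcript A s k = h} := by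
    ext A
    simp [queried]
  rw [this]
  exact MeasurableSet.iUnion fun h => MeasurableSet.iUnion fun _ =>
    measurableSet_transcript s k h

theorem measurable_cost {n : ℕ} (s : Outmap n) (S : Set (Vertex n) → Prop) :
    Measurable fun A : DetAlgorithm n =>
      ((⨅ (k : ℕ) (_ : S (queried A s k)), (k : ℕ∞) : ℕ∞) : ℝ≥0∞) := by
  classical
  simp only [ENat.toENNReal_iInf]
  refine Measurable.iInf fun k => ?_
  have : (fun A : DetAlgorithm n => (⨅ (_ : S (queried A s k)), ((k : ℕ∞) : ℝ≥0∞))) =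
      fun A => if A ∈ {A : DetAlgorithm n | S (queried A s k)} then ((k : ℕ∞) : ℝ≥0∞) else ⊤ := by
    funext A
    by_cases h : S (queried A s k) <;> simp [h]
  rw [this]
  exact Measurable.ite (measurableSet_queried s S k) measurable_const measurable_const

/-- The number of queries is a random variable. -/
theorem measurable_costSink {n : ℕ} (s : Outmap n) :
    Measurable fun A : DetAlgorithm n => (costSink A s : ℝ≥0∞) :=
  measurable_cost s (SolvesSink s)

/-- The number of queries is a random variable. -/
theorem measurable_costSinkOrClash {n : ℕ} (s : Outmap n) :
    Measurable fun A : DetAlgorithm n => (costSinkOrClash A s : ℝ≥0∞) :=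
  measurable_cost s (SolvesSinkOrClash s)

/-- Every outmap has a sink or a clash. -/
theorem exists_sink_or_clash {n : ℕ} (s : Outmap n) : SolvesSinkOrClash s Set.univ := by
  by_cases h : ∃ u v, IsClash s u v
  · obtain ⟨u, v, h⟩ := h
    exact Or.inr ⟨u, trivial, v, trivial, h⟩
  · left
    have hinj : Function.Injective s := by
      intro u v huv
      by_contra hne
      exact h ⟨u, v, hne, fun i => by simp [huv]⟩
    obtain ⟨u, hu⟩ := (Finite.injective_iff_surjective.mp hinj) (fun _ => false)
    exact ⟨u, trivial, fun i => by rw [hu]⟩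

/-- Some algorithm queries all vertices within a fixed number of queries. -/
theorem exists_exhaustive (n : ℕ) :
    ∃ (A : DetAlgorithm n) (N : ℕ), ∀ s, queried A s N = Set.univ := by
  classical
  let e := Fintype.equivFin (Vertex n)
  let N := Fintype.card (Vertex n)
  let A : DetAlgorithm n := fun h => if hl : h.length < N then e.symm ⟨h.length, hl⟩ else default
  have hlen : ∀ s k, (transcript A s k).length = k := by
    intro s k
    induction k with
    | zero => rfl
    | succ k ih => simp [transcript, ih]
  have hmem : ∀ s k j, j < k → ∃ p ∈ transcript A s k, p.1 = A (transcript A s j) := by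
    intro s k
    induction k with
    | zero => intro j hj; omega
    | succ k ih =>
      intro j hj
      rcases Nat.lt_succ_iff_lt_or_eq.mp hj with h | rfl
      · obtain ⟨p, hp, hpe⟩ := ih j h
        exact ⟨p, List.mem_cons_of_mem _ hp, hpe⟩
      · exact ⟨_, List.mem_cons_self, rfl⟩
  refine ⟨A, N, fun s => Set.eq_univ_of_forall fun v => ?_⟩
  obtain ⟨p, hp, hpe⟩ := hmem s N (e v) (e v).isLt
  refine ⟨p, hp, ?_⟩
  rw [hpe]
  have h1 : (transcript A s (e v)).length < N := by rw [hlen]; exact (e v).isLt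
  change (if hl : _ then _ else _) = v
  rw [dif_pos h1]
  apply e.injective
  rw [Equiv.apply_symm_apply]
  exact Fin.ext (hlen s _)

/-- `t(n)` is finite. -/
theorem t_ne_top (n : ℕ) : t n ≠ ⊤ := by
  obtain ⟨A, N, h⟩ := exists_exhaustive n
  refine ne_top_of_le_ne_top (ENat.natCast_ne_top N) ((iInf_le _ A).trans (iSup_le fun s => ?_))
  exact iInf₂_le N (by rw [h]; exact exists_sink_or_clash s)

end SinkOrClash

namespace SinkOrClash

/-! The outmap of a USO has no clash: on every face it realizes each pattern exactly once
(Szabó–Welzl). Hence on USO inputs every solution of Sink-or-Clash is a sink, and both comparisons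
hold algorithm by algorithm and input by input.

For the lower bound an adversary maintains a complete clash-free outmap and replaces it by another
one agreeing with it on all queried vertices. It works inside a hypersink, a face with all boundary
edges incoming, of dimension set `D`. There the outmap is determined on few coordinates `L` and
uniform on each fibre over `L`. A query in a fresh fibre is answered by making the vertex the source
of that fibre; if the fibre is occupied, one coordinate that distinguishes the two vertices is first
moved into `L` (`AdversaryState.query`). So `m` queries cost at most `m` coordinates of `L`.

After a phase of `m < 2 ^ k` queries, some pattern on `k` coordinates outside `L` is missed by all
queried vertices. The subface with this pattern can be made a hypersink with a fresh uniform outmap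
(`AdversaryState.retreat`). Only these `k` dimensions are lost for good: `L` is released and reused.
With `m` about `n / 2` and `k` about `log n` there are about `n / log n` phases, hence `n ^ 2 / log
n` queries up to a constant. -/

theorem mem_face {n : ℕ} {u v : Vertex n} {I : Set (Fin n)} :
    v ∈ face u I ↔ ∀ i, i ∉ I → v i = u i := Iff.rfl

/-! ### Outmaps of unique sink orientations are free of clashes -/

theorem Orientation.isSinkOf_face_iff {n : ℕ} (ψ : Orientation n) (u v : Vertex n)
    (I : Set (Fin n)) :
    ψ.IsSinkOf (face u I) v ↔ v ∈ face u I ∧ ∀ i ∈ I, ψ.outmap v i = false := by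
  refine and_congr_right fun hv => ⟨fun h i hi => ?_, ?_⟩
  · refine h _ (fun j hj => ?_) ⟨i, rfl⟩
    have hji : j ≠ i := fun e => hj (e ▸ hi)
    rw [neighbor, Function.update_of_ne hji, hv j hj]
  · rintro h w hw ⟨i, rfl⟩
    refine h i ?_
    by_contra hi
    have h1 := hw i hi
    have h2 := hv i hi
    simp [neighbor, h2] at h1

/-- If every face has exactly one sink, then every pattern of outgoing edges occurs exactly once
in every face. -/
theorem existsUnique_pattern {n : ℕ} {s : Outmap n}
    (h : ∀ (u : Vertex n) (I : Set (Fin n)), ∃! v, v ∈ face u I ∧ ∀ i ∈ I, s v i = false)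
    (T : Finset (Fin n)) (u : Vertex n) (I : Set (Fin n)) :
    ∃! v, v ∈ face u I ∧ ∀ i ∈ I, s v i = decide (i ∈ T) := by
  induction T using Finset.induction_on generalizing u I with
  | empty => simpa using h u I
  | insert j T hj ih =>
    by_cases hI : j ∈ I
    · obtain ⟨c, ⟨hc, hcT⟩, hcu⟩ := ih u I
      obtain ⟨d, ⟨hd, hdT⟩, hdu⟩ := ih (neighbor c j) (I \ {j})
      have hdj : d j = !c j := by
        rw [hd j (by simp)]
        simp [neighbor]
      have hdI : d ∈ face u I := fun i hi => by
        have hij : i ≠ j := fun e => hi (e ▸ hI)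
        rw [hd i (fun hh => hi hh.1), neighbor, Function.update_of_ne hij, hc i hi]
      -- Otherwise `d` has pattern `T` on all of `I`, so it is `c`, although it lies in the opposite
      -- facet.
      have hdne : s d j = true := by
        by_contra hs
        have : d = c := hcu d ⟨hdI, fun i hi => by
          by_cases hij : i = j
          · subst hij
            simpa [hj] using hs
          · exact hdT i ⟨hi, hij⟩⟩
        rw [this] at hdj
        simp at hdj
      refine ⟨d, ⟨hdI, fun i hi => ?_⟩, ?_⟩
      · by_cases hij : i = j
        · subst hij
          simpa using hdne
        · simp [hdT i ⟨hi, hij⟩, hij]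
      · rintro e ⟨he, heT⟩
        have heT' : ∀ i ∈ I \ {j}, s e i = decide (i ∈ T) := fun i hi => by
          have : i ≠ j := hi.2
          simp [heT i hi.1, this]
        have hej : s e j = true := by simp [heT j hI]
        have hec : ∀ i, i ∉ I → e i = c i := fun i hi => by rw [he i hi, hc i hi]
        -- On the side of `c`, uniqueness for `I \ {j}` forces `e = c`, whose bit `j` is wrong; on
        -- the other side it forces `e = d`.
        by_cases hjc : e j = c j
        · have hmem : e ∈ face c (I \ {j}) := fun i hi => by
            by_cases hij : i = j
            · rw [hij, hjc]
            · exact hec i fun hh => hi ⟨hh, hij⟩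
          have := (ih c (I \ {j})).unique ⟨hmem, heT'⟩ ⟨fun i _ => rfl, fun i hi => hcT i hi.1⟩
          rw [this, hcT j hI] at hej
          simp [hj] at hej
        · refine hdu e ⟨fun i hi => ?_, heT'⟩
          by_cases hij : i = j
          · subst hij
            simpa [neighbor, Bool.eq_not] using hjc
          · rw [neighbor, Function.update_of_ne hij]
            exact hec i fun hh => hi ⟨hh, hij⟩
    · convert ih u I using 5 with v i hi
      have : i ≠ j := fun e => hI (e ▸ hi)
      simp [this]

/-- In the face spanned by the coordinates where `u` and `v` differ, a clash would make both realize
the same pattern. -/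
theorem RepresentsUSO.not_isClash {n : ℕ} {s : Outmap n} (hs : RepresentsUSO s)
    (u v : Vertex n) : ¬ IsClash s u v := by
  obtain ⟨ψ, hψ, rfl⟩ := hs
  rintro ⟨hne, h⟩
  have hsink : ∀ (u : Vertex n) (I : Set (Fin n)),
      ∃! v, v ∈ face u I ∧ ∀ i ∈ I, ψ.outmap v i = false := fun u I => by
    simpa only [ψ.isSinkOf_face_iff] using hψ u I
  refine hne ((existsUnique_pattern hsink (Finset.univ.filter fun i => ψ.outmap u i = true) u
    {i | u i ≠ v i}).unique ⟨fun i _ => rfl, fun i _ => by simp⟩ ⟨fun i hi => ?_, fun i hi => ?_⟩)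
  · have : u i = v i := by simpa using hi
    exact this.symm
  · have h1 := h i
    have h2 : u i ≠ v i := hi
    have h3 : ψ.outmap u i = ψ.outmap v i := by
      simpa [h2] using h1
    simp [h3]

theorem costSink_le_costSinkOrClash {n : ℕ} (A : DetAlgorithm n) {s : Outmap n}
    (hs : RepresentsUSO s) : costSink A s ≤ costSinkOrClash A s := by
  refine le_iInf₂ fun k hk => iInf₂_le k ?_
  rcases hk with h | ⟨u, -, v, -, h⟩
  · exact h
  · exact absurd h (hs.not_isClash u v)

theorem q_le_t (n : ℕ) : q n ≤ t n :=
  iInf_mono fun A => iSup_le fun s => iSup_le fun hs =>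
    (costSink_le_costSinkOrClash A hs).trans (le_iSup (fun s => costSinkOrClash A s) s)

theorem qRand_le_tRand (n : ℕ) : qRand n ≤ tRand n :=
  iInf_mono fun P => iSup_le fun s => iSup_le fun hs =>
    (lintegral_mono fun A => ENat.toENNReal_le.mpr (costSink_le_costSinkOrClash A hs)).trans
      (le_iSup (fun s => ∫⁻ A, (costSinkOrClash A s : ℝ≥0∞) ∂(P : Measure (DetAlgorithm n))) s)

/-! ### Adversary states -/

/-- `u` and `v` have the same coordinates in `L`. -/
def AgreeOn {n : ℕ} (L : Finset (Fin n)) (u v : Vertex n) : Prop := ∀ i ∈ L, u i = v i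

theorem AgreeOn.symm {n : ℕ} {L : Finset (Fin n)} {u v : Vertex n} (h : AgreeOn L u v) :
    AgreeOn L v u := fun i hi => (h i hi).symm

theorem AgreeOn.trans {n : ℕ} {L : Finset (Fin n)} {u v w : Vertex n} (h : AgreeOn L u v)
    (h' : AgreeOn L v w) : AgreeOn L u w := fun i hi => (h i hi).trans (h' i hi)

theorem AgreeOn.mono {n : ℕ} {L L' : Finset (Fin n)} {u v : Vertex n} (h : AgreeOn L' u v)
    (hL : L ⊆ L') : AgreeOn L u v := fun i hi => h i (hL hi)

theorem AgreeOn.exists_diff {n : ℕ} {D L : Finset (Fin n)} {f u v : Vertex n} (hL : AgreeOn L u v)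
    (hu : u ∈ face f (D : Set (Fin n))) (hv : v ∈ face f (D : Set (Fin n))) (hne : u ≠ v) :
    ∃ i ∈ D, i ∉ L ∧ u i ≠ v i := by
  obtain ⟨i, hi⟩ := Function.ne_iff.mp hne
  refine ⟨i, ?_, fun hiL => hi (hL i hiL), hi⟩
  by_contra hD
  exact hi ((hu i (by simpa using hD)).trans (hv i (by simpa using hD)).symm)

/-- Some coordinate in which `u` and `v` differ witnesses that they do not clash. -/
def Separated {n : ℕ} (s : Outmap n) (u v : Vertex n) : Prop := ∃ i, u i ≠ v i ∧ s u i ≠ s v i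

theorem Separated.not_isClash {n : ℕ} {s : Outmap n} {u v : Vertex n} (h : Separated s u v) :
    ¬ IsClash s u v := by
  obtain ⟨i, h1, h2⟩ := h
  rintro ⟨-, h⟩
  have h3 := h i
  simp [h1, h2] at h3

/-- The knowledge of the adversary. The face `face f D` is a hypersink of `s`. Inside this face,
`s` is a product: a fixed outmap on the coordinates in `L`, and a uniform outmap on `D \ L` in each
of its fibres. The queried vertices `W` of the face are the sources of their fibres. -/
structure AdversaryState {n : ℕ} (D L : Finset (Fin n)) (f : Vertex n) (s : Outmap n)
    (W : Finset (Vertex n)) : Prop where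
  subset : L ⊆ D
  incoming : ∀ u ∈ face f (D : Set (Fin n)), ∀ i ∉ D, s u i = false
  outgoing : ∀ u ∉ face f (D : Set (Fin n)), ∃ j ∉ D, u j ≠ f j ∧ s u j = true
  separated : ∀ u v, u ∉ face f (D : Set (Fin n)) → v ∉ face f (D : Set (Fin n)) → u ≠ v →
    Separated s u v
  same_fibre : ∀ u ∈ face f (D : Set (Fin n)), ∀ v ∈ face f (D : Set (Fin n)), AgreeOn L u v →
    ∀ i ∈ L, s u i = s v i
  diff_fibre : ∀ u ∈ face f (D : Set (Fin n)), ∀ v ∈ face f (D : Set (Fin n)), ¬ AgreeOn L u v →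
    ∃ i ∈ L, u i ≠ v i ∧ s u i ≠ s v i
  uniform : ∀ u ∈ face f (D : Set (Fin n)), ∀ v ∈ face f (D : Set (Fin n)), AgreeOn L u v →
    ∀ i ∈ D, i ∉ L → (s u i = s v i ↔ u i = v i)
  mem_face : ∀ w ∈ W, w ∈ face f (D : Set (Fin n))
  inj : ∀ w ∈ W, ∀ w' ∈ W, AgreeOn L w w' → w = w'
  source : ∀ w ∈ W, ∀ i ∈ D, i ∉ L → s w i = true

/-! ### Answering queries inside the hypersink. -/

namespace AdversaryState

variable {n : ℕ} {D L : Finset (Fin n)} {f : Vertex n} {s : Outmap n} {W : Finset (Vertex n)}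

/-- The separating coordinate lies in `D \ L` within a fibre, in `L` between fibres, and outside `D`
across the boundary of the face. -/
theorem separated_of_ne (h : AdversaryState D L f s W) {u v : Vertex n} (hne : u ≠ v) :
    Separated s u v := by
  by_cases hu : u ∈ face f (D : Set (Fin n)) <;> by_cases hv : v ∈ face f (D : Set (Fin n))
  · by_cases hL : AgreeOn L u v
    · obtain ⟨i, hD, hiL, hi⟩ := hL.exists_diff hu hv hne
      exact ⟨i, hi, fun e => hi ((h.uniform u hu v hv hL i hD hiL).mp e)⟩
    · obtain ⟨i, -, hi⟩ := h.diff_fibre u hu v hv hL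
      exact ⟨i, hi⟩
  · obtain ⟨j, hj, hne, ht⟩ := h.outgoing v hv
    refine ⟨j, ?_, by simp [ht, h.incoming u hu j hj]⟩
    rw [hu j (by simpa using hj)]
    exact hne.symm
  · obtain ⟨j, hj, hne, ht⟩ := h.outgoing u hu
    refine ⟨j, ?_, by simp [ht, h.incoming v hv j hj]⟩
    rw [hv j (by simpa using hj)]
    exact hne
  · exact h.separated u v hu hv hne

/-- Vertices outside the face have an edge towards it; those in `W` are sources of fibres of
positive dimension. -/
theorem not_isSink (h : AdversaryState D L f s W) (hDL : (D \ L).Nonempty) {u : Vertex n}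
    (hu : u ∈ face f (D : Set (Fin n)) → u ∈ W) : ¬ IsSink s u := by
  intro hs
  by_cases hf : u ∈ face f (D : Set (Fin n))
  · obtain ⟨i, hi⟩ := hDL
    rw [Finset.mem_sdiff] at hi
    simpa [hs i] using h.source u (hu hf) i hi.1 hi.2
  · obtain ⟨j, -, -, hj⟩ := h.outgoing u hf
    simp [hs j] at hj

/-- A uniform outmap is a product over its coordinates, so any of them can join the fixed factor
without changing `s`. -/
theorem insert_coord (h : AdversaryState D L f s W) {i : Fin n} (hi : i ∈ D) (hiL : i ∉ L) :
    AdversaryState D (insert i L) f s W where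
  subset := Finset.insert_subset hi h.subset
  incoming := h.incoming
  outgoing := h.outgoing
  separated := h.separated
  same_fibre u hu v hv huv j hj := by
    have huv' := huv.mono (Finset.subset_insert i L)
    rcases Finset.mem_insert.mp hj with rfl | hj
    · exact (h.uniform u hu v hv huv' j hi hiL).mpr (huv j (Finset.mem_insert_self _ _))
    · exact h.same_fibre u hu v hv huv' j hj
  diff_fibre u hu v hv huv := by
    by_cases hL : AgreeOn L u v
    · have hne : u i ≠ v i := fun e => huv fun j hj => by
        rcases Finset.mem_insert.mp hj with rfl | hj
        exacts [e, hL j hj]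
      exact ⟨i, Finset.mem_insert_self _ _, hne,
        fun e => hne ((h.uniform u hu v hv hL i hi hiL).mp e)⟩
    · obtain ⟨j, hj, hj'⟩ := h.diff_fibre u hu v hv hL
      exact ⟨j, Finset.mem_insert_of_mem hj, hj'⟩
  uniform u hu v hv huv j hj hjL :=
    h.uniform u hu v hv (huv.mono (Finset.subset_insert i L)) j hj
      fun hh => hjL (Finset.mem_insert_of_mem hh)
  mem_face := h.mem_face
  inj w hw w' hw' hww := h.inj w hw w' hw' (hww.mono (Finset.subset_insert i L))
  source w hw j hj hjL := h.source w hw j hj fun hh => hjL (Finset.mem_insert_of_mem hh)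

open Classical in
/-- Answering a query in a fibre that has not been queried before. -/
theorem query_fresh (h : AdversaryState D L f s W) {v : Vertex n}
    (hv : v ∈ face f (D : Set (Fin n))) (hfresh : ∀ w ∈ W, ¬ AgreeOn L w v) :
    ∃ s' : Outmap n, (∀ u, (u ∈ face f (D : Set (Fin n)) → u ∈ W) → s' u = s u) ∧
      AdversaryState D L f s' (insert v W) := by
  -- Only the fibre of `v` changes: it receives the uniform outmap with source `v`.
  let s' : Outmap n := fun u i =>
    if u ∈ face f (D : Set (Fin n)) ∧ AgreeOn L u v ∧ i ∈ D ∧ i ∉ L then u i == v i else s u i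
  have hout : ∀ u, u ∉ face f (D : Set (Fin n)) → s' u = s u := fun u hu => by
    funext i
    simp [s', hu]
  have hW : ∀ u, ¬ AgreeOn L u v → s' u = s u := fun u hu => by
    funext i
    simp [s', hu]
  have hD : ∀ u, ∀ i ∉ D, s' u i = s u i := fun u i hi => by simp [s', hi]
  have hL : ∀ u, ∀ i ∈ L, s' u i = s u i := fun u i hi => by simp [s', hi]
  have hmem : ∀ u ∈ face f (D : Set (Fin n)), AgreeOn L u v → ∀ i ∈ D, i ∉ L →
      s' u i = (u i == v i) := fun u hu huv i hi hiL => if_pos ⟨hu, huv, hi, hiL⟩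
  refine ⟨s', fun u hu => ?_, ?_⟩
  · by_cases hf : u ∈ face f (D : Set (Fin n))
    · exact hW u (hfresh u (hu hf))
    · exact hout u hf
  constructor
  · exact h.subset
  · exact fun u hu i hi => by rw [hD u i hi, h.incoming u hu i hi]
  · exact fun u hu => by simpa only [hout u hu] using h.outgoing u hu
  · intro u w hu hw hne
    simpa only [Separated, hout u hu, hout w hw] using h.separated u w hu hw hne
  · exact fun u hu w hw huw i hi => by rw [hL u i hi, hL w i hi, h.same_fibre u hu w hw huw i hi]
  · intro u hu w hw huw
    obtain ⟨i, hi, hi'⟩ := h.diff_fibre u hu w hw huw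
    exact ⟨i, hi, by simpa only [hL _ i hi] using hi'⟩
  · intro u hu w hw huw i hi hiL
    by_cases huv : AgreeOn L u v
    · rw [hmem u hu huv i hi hiL, hmem w hw (huw.symm.trans huv) i hi hiL]
      cases u i <;> cases w i <;> cases v i <;> simp
    · rw [hW u huv, hW w fun hh => huv (huw.trans hh)]
      exact h.uniform u hu w hw huw i hi hiL
  · intro w hw
    rcases Finset.mem_insert.mp hw with rfl | hw
    exacts [hv, h.mem_face w hw]
  · intro w hw w' hw' hww
    rcases Finset.mem_insert.mp hw with rfl | hw <;>
      rcases Finset.mem_insert.mp hw' with rfl | hw'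
    · rfl
    · exact absurd hww.symm (hfresh w' hw')
    · exact absurd hww (hfresh w (by assumption))
    · exact h.inj w hw w' hw' hww
  · intro w hw i hi hiL
    rcases Finset.mem_insert.mp hw with rfl | hw
    · rw [hmem w hv (fun _ _ => rfl) i hi hiL]
      simp
    · rw [hW w (hfresh w hw)]
      exact h.source w hw i hi hiL

/-- Answering a query inside the current face. -/
theorem query (h : AdversaryState D L f s W) {v : Vertex n}
    (hv : v ∈ face f (D : Set (Fin n))) :
    ∃ (L' : Finset (Fin n)) (s' : Outmap n), L'.card ≤ L.card + 1 ∧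
      (∀ u, (u ∈ face f (D : Set (Fin n)) → u ∈ W) → s' u = s u) ∧
      AdversaryState D L' f s' (insert v W) := by
  by_cases hvW : v ∈ W
  · exact ⟨L, s, Nat.le_succ _, fun _ _ => rfl, by rwa [Finset.insert_eq_of_mem hvW]⟩
  by_cases hfresh : ∀ w ∈ W, ¬ AgreeOn L w v
  · obtain ⟨s', hs, h'⟩ := h.query_fresh hv hfresh
    exact ⟨L, s', Nat.le_succ _, hs, h'⟩
  · push Not at hfresh
    obtain ⟨w, hw, hwv⟩ := hfresh
    obtain ⟨i, hi, hiL, hne⟩ := hwv.exists_diff (h.mem_face w hw) hv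
      fun e => hvW (e ▸ hw)
    -- By `inj`, `w` was the only queried vertex of the old fibre, and coordinate `i` now splits it
    -- off from `v`.
    obtain ⟨s', hs, h'⟩ := (h.insert_coord hi hiL).query_fresh hv fun w' hw' hwv' => by
      have := h.inj w' hw' w hw ((hwv'.mono (Finset.subset_insert i L)).trans hwv.symm)
      subst this
      exact hne (hwv' i (Finset.mem_insert_self _ _))
    exact ⟨_, s', Finset.card_insert_le _ _, hs, h'⟩

end AdversaryState

/-- Fewer than `2 ^ |J|` vertices cannot realize all patterns on `J`. -/
theorem exists_missed_pattern {n : ℕ} (J : Finset (Fin n)) (W : Finset (Vertex n))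
    (hW : W.card < 2 ^ J.card) : ∃ g : Vertex n, ∀ w ∈ W, ∃ j ∈ J, w j ≠ g j := by
  classical
  let r : Vertex n → (J → Bool) := fun w j => w j
  have hlt : (W.image r).card < (Finset.univ : Finset (J → Bool)).card := by
    refine Finset.card_image_le.trans_lt ?_
    simpa using hW
  obtain ⟨x, -, hx⟩ := Finset.exists_mem_notMem_of_card_lt_card hlt
  refine ⟨fun i => if hi : i ∈ J then x ⟨i, hi⟩ else false, fun w hw => ?_⟩
  by_contra! hcon
  refine hx (Finset.mem_image.mpr ⟨w, hw, ?_⟩)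
  funext j
  simpa using hcon j j.2

/-! ### Shrinking the hypersink at the end of a phase. -/

namespace AdversaryState

variable {n : ℕ} {D L : Finset (Fin n)} {f : Vertex n} {s : Outmap n} {W : Finset (Vertex n)}

open Classical in
/-- Retreating to a hypersink of the current face that contains no queried vertex. -/
theorem retreat (h : AdversaryState D L f s W) {J : Finset (Fin n)} (hJ : J ⊆ D \ L)
    (hW : W.card < 2 ^ J.card) :
    ∃ (f' : Vertex n) (s' : Outmap n),
      (∀ u, (u ∈ face f (D : Set (Fin n)) → u ∈ W) →
        u ∉ face f' ((D \ J : Finset (Fin n)) : Set (Fin n)) ∧ s' u = s u) ∧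
      AdversaryState (D \ J) ∅ f' s' ∅ := by
  obtain ⟨g, hg⟩ := exists_missed_pattern J W hW
  have hJD : ∀ j ∈ J, j ∈ D := fun j hj => (Finset.mem_sdiff.mp (hJ hj)).1
  have hJL : ∀ j ∈ J, j ∉ L := fun j hj => (Finset.mem_sdiff.mp (hJ hj)).2
  choose e heJ he using hg
  let f' : Vertex n := fun i => if i ∈ J then g i else f i
  have hface : ∀ u, u ∈ face f' ((D \ J : Finset (Fin n)) : Set (Fin n)) ↔
      u ∈ face f (D : Set (Fin n)) ∧ AgreeOn J u g := by
    intro u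
    simp only [SinkOrClash.mem_face, AgreeOn, Finset.mem_coe, Finset.mem_sdiff, f']
    constructor
    · intro hu
      refine ⟨fun i hi => ?_, fun j hj => ?_⟩
      · simpa [show i ∉ J from fun hj => hi (hJD i hj)] using hu i fun hh => hi hh.1
      · simpa [hj] using hu j fun hh => hh.2 hj
    · rintro ⟨h1, h2⟩ i hi
      by_cases hij : i ∈ J
      · simpa [hij] using h2 i hij
      · simpa [hij] using h1 i fun hh => hi ⟨hh, hij⟩
  -- `K u`: the vertex `u` lies on the side of a queried vertex of its fibre
  let K : Vertex n → Prop := fun u => ∃ (w : Vertex n) (hw : w ∈ W), AgreeOn L u w ∧ u (e w hw) = w (e w hw)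
  -- The new face gets a uniform outmap with sink at the zero bits. Elsewhere in the old face,
  -- vertices off the queried sides have their `J`-edges directed towards `g`; all others, including
  -- the queried vertices, keep their values.
  let s' : Outmap n := fun u i =>
    if u ∈ face f (D : Set (Fin n)) then
      if AgreeOn J u g then (if i ∈ D \ J then u i else false)
      else if i ∈ J ∧ ¬ K u then u i != g i else s u i
    else s u i
  have hout : ∀ u, u ∉ face f (D : Set (Fin n)) → s' u = s u := fun u hu => by
    funext i
    simp [s', hu]
  have hin : ∀ u ∈ face f (D : Set (Fin n)), AgreeOn J u g → ∀ i,
      s' u i = if i ∈ D \ J then u i else false := fun u hu hug i => by simp only [s', hu, hug, if_true]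
  have hmid : ∀ u ∈ face f (D : Set (Fin n)), ¬ AgreeOn J u g → ∀ i,
      s' u i = if i ∈ J ∧ ¬ K u then u i != g i else s u i := fun u hu hug i => by
    simp only [s', hu, hug, if_true, if_false]
  have hKs : ∀ u ∈ face f (D : Set (Fin n)), ¬ AgreeOn J u g → K u → s' u = s u :=
    fun u hu hug hK => by
      funext i
      rw [hmid u hu hug i, if_neg (fun hh => hh.2 hK)]
  have hKe : ∀ u ∈ face f (D : Set (Fin n)), ∀ (w : Vertex n) (hw : w ∈ W), AgreeOn L u w →
      u (e w hw) = w (e w hw) → s u (e w hw) = true := fun u hu w hw huw hew => by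
    rw [(h.uniform u hu w (h.mem_face w hw) huw (e w hw) (hJD _ (heJ w hw)) (hJL _ (heJ w hw))).mpr hew]
    exact h.source w hw _ (hJD _ (heJ w hw)) (hJL _ (heJ w hw))
  have hWg : ∀ w ∈ W, ¬ AgreeOn J w g := fun w hw hh => he w hw (hh _ (heJ w hw))
  have hmixed : ∀ u ∈ face f (D : Set (Fin n)), ∀ v ∈ face f (D : Set (Fin n)),
      ¬ AgreeOn J u g → ¬ AgreeOn J v g → AgreeOn L u v → K u → ¬ K v → Separated s' u v := by
    rintro u hu v hv hug hvg huv ⟨w, hw, huw, hew⟩ hKv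
    have hve : v (e w hw) ≠ w (e w hw) := fun hh => hKv ⟨w, hw, huv.symm.trans huw, hh⟩
    -- Here `u` inherits the outgoing edge of the source `w`, whereas `v` already has the bit of
    -- `g`, so its redirected edge is incoming.
    refine ⟨e w hw, fun hh => hve (hh ▸ hew), ?_⟩
    rw [hKs u hu hug ⟨w, hw, huw, hew⟩, hKe u hu w hw huw hew, hmid v hv hvg,
      if_pos ⟨heJ w hw, hKv⟩]
    have := he w hw
    revert this hve
    cases v (e w hw) <;> cases w (e w hw) <;> cases g (e w hw) <;> simp
  have hsymm : ∀ u v, Separated s' u v → Separated s' v u := fun u v ⟨i, h1, h2⟩ =>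
    ⟨i, h1.symm, h2.symm⟩
  have hmidsep : ∀ u ∈ face f (D : Set (Fin n)), ∀ v ∈ face f (D : Set (Fin n)),
      ¬ AgreeOn J u g → ¬ AgreeOn J v g → u ≠ v → Separated s' u v := by
    intro u hu v hv hug hvg hne
    by_cases huv : AgreeOn L u v
    · by_cases hKu : K u <;> by_cases hKv : K v
      · simpa only [Separated, hKs u hu hug hKu, hKs v hv hvg hKv] using h.separated_of_ne hne
      · exact hmixed u hu v hv hug hvg huv hKu hKv
      · exact hsymm _ _ (hmixed v hv u hu hvg hug huv.symm hKv hKu)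
      · obtain ⟨i, hi, hiL, hdiff⟩ := huv.exists_diff hu hv hne
        refine ⟨i, hdiff, ?_⟩
        rw [hmid u hu hug, hmid v hv hvg]
        by_cases hiJ : i ∈ J
        · rw [if_pos ⟨hiJ, hKu⟩, if_pos ⟨hiJ, hKv⟩]
          revert hdiff
          cases u i <;> cases v i <;> cases g i <;> simp
        · rw [if_neg (fun hh => hiJ hh.1), if_neg (fun hh => hiJ hh.1)]
          exact fun hh => hdiff ((h.uniform u hu v hv huv i hi hiL).mp hh)
    · obtain ⟨i, hi, hdiff, hs⟩ := h.diff_fibre u hu v hv huv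
      have hiJ : i ∉ J := fun hh => hJL i hh hi
      refine ⟨i, hdiff, ?_⟩
      rwa [hmid u hu hug, hmid v hv hvg, if_neg (fun hh => hiJ hh.1), if_neg (fun hh => hiJ hh.1)]
  have hcross : ∀ u ∉ face f (D : Set (Fin n)), ∀ v ∈ face f (D : Set (Fin n)),
      Separated s' u v := by
    intro u hu v hv
    obtain ⟨j, hj, hne, ht⟩ := h.outgoing u hu
    refine ⟨j, by rwa [hv j (by simpa using hj)], ?_⟩
    have hjJ : j ∉ J := fun hh => hj (hJD j hh)
    have : s' v j = false := by
      by_cases hvg : AgreeOn J v g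
      · rw [hin v hv hvg, if_neg (fun hh => hj (Finset.mem_sdiff.mp hh).1)]
      · rw [hmid v hv hvg, if_neg (fun hh => hjJ hh.1), h.incoming v hv j hj]
    rw [this, hout u hu, ht]
    simp
  refine ⟨f', s', fun u hu => ?_, ?_⟩
  · by_cases hf : u ∈ face f (D : Set (Fin n))
    · have hug := hWg u (hu hf)
      exact ⟨fun hh => hug ((hface u).mp hh).2,
        hKs u hf hug ⟨u, hu hf, fun _ _ => rfl, rfl⟩⟩
    · exact ⟨fun hh => hf ((hface u).mp hh).1, hout u hf⟩
  constructor
  · simp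
  · intro u hu i hi
    rw [hface] at hu
    rw [hin u hu.1 hu.2, if_neg hi]
  · intro u hu
    rw [hface] at hu
    by_cases hf : u ∈ face f (D : Set (Fin n))
    · have hug : ¬ AgreeOn J u g := fun hh => hu ⟨hf, hh⟩
      -- The edge towards the new face is `e w` on a queried side, and otherwise any `J`-coordinate
      -- where `u` differs from `g`.
      by_cases hK : K u
      · obtain ⟨w, hw, huw, hew⟩ := hK
        refine ⟨e w hw, fun hh => (Finset.mem_sdiff.mp hh).2 (heJ w hw), ?_, ?_⟩
        · simpa [f', heJ w hw, hew] using he w hw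
        · rw [hKs u hf hug ⟨w, hw, huw, hew⟩, hKe u hf w hw huw hew]
      · have hug' := hug
        simp only [AgreeOn, not_forall] at hug'
        obtain ⟨j, hj, hne⟩ := hug'
        refine ⟨j, fun hh => (Finset.mem_sdiff.mp hh).2 hj, by simpa [f', hj] using hne, ?_⟩
        rw [hmid u hf hug, if_pos ⟨hj, hK⟩]
        simpa using hne
    · obtain ⟨j, hj, hne, ht⟩ := h.outgoing u hf
      have hjJ : j ∉ J := fun hh => hj (hJD j hh)
      exact ⟨j, fun hh => hj (Finset.mem_sdiff.mp hh).1, by simpa [f', hjJ] using hne,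
        by rw [hout u hf, ht]⟩
  · intro u v hu hv hne
    rw [hface] at hu hv
    by_cases hfu : u ∈ face f (D : Set (Fin n)) <;> by_cases hfv : v ∈ face f (D : Set (Fin n))
    · exact hmidsep u hfu v hfv (fun hh => hu ⟨hfu, hh⟩) (fun hh => hv ⟨hfv, hh⟩) hne
    · exact hsymm _ _ (hcross v hfv u hfu)
    · exact hcross u hfu v hfv
    · simpa only [Separated, hout u hfu, hout v hfv] using h.separated u v hfu hfv hne
  · simp
  · exact fun u _ v _ huv => absurd (fun i hi => absurd hi (Finset.notMem_empty i)) huv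
  · intro u hu v hv _ i hi _
    rw [hface] at hu hv
    rw [hin u hu.1 hu.2, hin v hv.1 hv.2, if_pos hi, if_pos hi]
  · simp
  · simp
  · simp

end AdversaryState
/-! ### The lower bound -/

theorem queried_succ {n : ℕ} (A : DetAlgorithm n) (s : Outmap n) (k : ℕ) :
    queried A s (k + 1) = insert (A (transcript A s k)) (queried A s k) := by
  ext v
  simp [queried, transcript, eq_comm]

theorem queried_mono {n : ℕ} (A : DetAlgorithm n) (s : Outmap n) : Monotone (queried A s) :=
  monotone_nat_of_le_succ fun k => by
    rw [queried_succ]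
    exact Set.subset_insert _ _

/-- This lets the adversary exchange its outmap without the algorithm noticing. -/
theorem transcript_congr {n : ℕ} {A : DetAlgorithm n} {s s' : Outmap n} {k : ℕ}
    (h : ∀ u ∈ queried A s k, s' u = s u) : transcript A s' k = transcript A s k := by
  induction k with
  | zero => rfl
  | succ k ih =>
    rw [queried_succ] at h
    have := ih fun u hu => h u (Set.mem_insert_of_mem _ hu)
    simp only [transcript, this]
    rw [h _ (Set.mem_insert _ _)]

theorem queried_congr {n : ℕ} {A : DetAlgorithm n} {s s' : Outmap n} {k : ℕ}
    (h : ∀ u ∈ queried A s k, s' u = s u) : queried A s' k = queried A s k := by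
  simp only [queried, transcript_congr h]

theorem AdversaryState.exists_next {n : ℕ} (A : DetAlgorithm n) {D L : Finset (Fin n)}
    {f : Vertex n} {s : Outmap n} {W : Finset (Vertex n)} {l : ℕ} (h : AdversaryState D L f s W)
    (hQ : ∀ u ∈ queried A s l, u ∈ face f (D : Set (Fin n)) → u ∈ W) :
    ∃ (L' : Finset (Fin n)) (s' : Outmap n) (W' : Finset (Vertex n)),
      L'.card ≤ L.card + 1 ∧ W'.card ≤ W.card + 1 ∧ AdversaryState D L' f s' W' ∧
      ∀ u ∈ queried A s' (l + 1), u ∈ face f (D : Set (Fin n)) → u ∈ W' := by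
  classical
  by_cases hv : A (transcript A s l) ∈ face f (D : Set (Fin n))
  · obtain ⟨L', s', hL', hs, h'⟩ := h.query hv
    refine ⟨L', s', _, hL', Finset.card_insert_le _ _, h', fun u hu hf => ?_⟩
    have hagree : ∀ u ∈ queried A s l, s' u = s u := fun u hu => hs u (hQ u hu)
    rw [queried_succ, queried_congr hagree, transcript_congr hagree] at hu
    rcases hu with rfl | hu
    · exact Finset.mem_insert_self _ _
    · exact Finset.mem_insert_of_mem (hQ u hu hf)
  -- A query outside the hypersink is answered by the current outmap at no cost.
  · refine ⟨L, s, W, Nat.le_succ _, Nat.le_succ _, h, fun u hu hf => ?_⟩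
    rw [queried_succ] at hu
    rcases hu with rfl | hu
    · exact absurd hf hv
    · exact hQ u hu hf

/-- Against any algorithm, the adversary survives the `r` remaining queries of the current phase
and `R` further phases of `m` queries each. -/
theorem AdversaryState.exists_hard_outmap {n : ℕ} (A : DetAlgorithm n) {m k : ℕ} (hm : m < 2 ^ k)
    (hk : 0 < k) (R r : ℕ) {D L : Finset (Fin n)} {f : Vertex n} {s : Outmap n}
    {W : Finset (Vertex n)} {l : ℕ} (h : AdversaryState D L f s W)
    (hQ : ∀ u ∈ queried A s l, u ∈ face f (D : Set (Fin n)) → u ∈ W)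
    (hW : W.card + r ≤ m) (hL : L.card + r ≤ m) (hD : m + k + R * k ≤ D.card) :
    ∃ s' : Outmap n, (∀ u v, ¬ IsClash s' u v) ∧
      ∀ u ∈ queried A s' (l + (r + R * m)), ¬ IsSink s' u := by
  classical
  induction R generalizing r D L f s W l with
  | zero =>
    induction r generalizing L s W l with
    | zero =>
      -- `L` uses at most `m` coordinates; the spare `k > 0` keeps the fibres nontrivial.
      have hDL : (D \ L).Nonempty := by
        rw [← Finset.card_pos]
        have := Finset.le_card_sdiff L D
        omega
      refine ⟨s, fun u v huv => (h.separated_of_ne huv.1).not_isClash huv, fun u hu => ?_⟩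
      exact h.not_isSink hDL (hQ u (by simpa using hu))
    | succ r ih =>
      obtain ⟨L', s', W', hL', hW', h', hQ'⟩ := h.exists_next A hQ
      simpa only [Nat.add_right_comm, Nat.add_assoc, Nat.add_comm 1] using
        ih h' hQ' (by omega) (by omega)
  | succ R ihR =>
    induction r generalizing L s W l with
    | zero =>
      have hDL : k ≤ (D \ L).card := by
        have := Finset.le_card_sdiff L D
        rw [Nat.succ_mul] at hD
        omega
      obtain ⟨J, hJ, hJk⟩ := Finset.exists_subset_card_eq hDL
      obtain ⟨f', s', hs, h'⟩ := h.retreat hJ (by rw [hJk]; omega)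
      have hagree : ∀ u ∈ queried A s l, s' u = s u := fun u hu => (hs u (hQ u hu)).2
      have hJD : J ⊆ D := hJ.trans Finset.sdiff_subset
      -- The new face contains no queried vertex, so the next phase starts with `L` and `W` empty
      -- and a full budget `m`.
      have := ihR m h' (l := l) (fun u hu hf => by
        rw [queried_congr hagree] at hu
        exact absurd hf (hs u (hQ u hu)).1) (by simp) (by simp) (by
          rw [Finset.card_sdiff_of_subset hJD, hJk]
          rw [Nat.succ_mul] at hD
          omega)
      rwa [show 0 + (R + 1) * m = m + R * m by ring]
    | succ r ih =>
      obtain ⟨L', s', W', hL', hW', h', hQ'⟩ := h.exists_next A hQ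
      simpa only [Nat.add_right_comm, Nat.add_assoc, Nat.add_comm 1] using
        ih h' hQ' (by omega) (by omega)

theorem adversaryState_univ (n : ℕ) :
    AdversaryState (n := n) Finset.univ ∅ (fun _ => false) (fun u => u) ∅ where
  subset := by simp
  incoming := by simp
  outgoing u hu := absurd (fun i hi => absurd (by simp) hi) hu
  separated u v hu _ _ := absurd (fun i hi => absurd (by simp) hi) hu
  same_fibre := by simp
  diff_fibre u _ v _ h := absurd (fun i hi => absurd hi (Finset.notMem_empty i)) h
  uniform := by simp
  mem_face := by simp
  inj := by simp
  source := by simp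

theorem le_toNat_t {n m k R : ℕ} (hm : m < 2 ^ k) (hk : 0 < k) (hn : m + k + R * k ≤ n) :
    (R + 1) * m ≤ (t n).toNat := by
  have hle : (((R + 1) * m : ℕ) : ℕ∞) ≤ t n := by
    refine le_iInf fun A => ?_
    obtain ⟨s, hclash, hsink⟩ := (adversaryState_univ n).exists_hard_outmap A hm hk R m (l := 0)
      (by simp [queried, transcript]) (by simp) (by simp) (by simpa using hn)
    refine le_trans ?_ (le_iSup _ s)
    refine le_iInf₂ fun j hj => ?_
    rcases hj with ⟨u, hu, hus⟩ | ⟨u, -, v, -, huv⟩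
    · by_contra! hlt
      have hlt' : j < (R + 1) * m := by exact_mod_cast hlt
      exact hsink u (queried_mono A s (by linarith) hu) hus
    · exact absurd huv (hclash u v)
  -- Finiteness of `t n` is essential, since `toNat` sends `⊤` to `0`.
  rw [← ENat.natCast_toNat (t_ne_top n)] at hle
  exact_mod_cast hle

theorem isBigO_toNat_t :
    (fun n : ℕ => (n : ℝ) ^ 2 / Real.log (n : ℝ)) =O[atTop] (fun n : ℕ => ((t n).toNat : ℝ)) := by
  have hlog : Tendsto (fun n : ℕ => Real.log n) atTop atTop :=
    Real.tendsto_log_atTop.comp tendsto_natCast_atTop_atTop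
  have hsmall : ∀ᶠ n : ℕ in atTop, Real.log n ≤ 1 / 12 * n := by
    have := (Real.isLittleO_log_id_atTop.comp_tendsto
      (tendsto_natCast_atTop_atTop (R := ℝ))).bound (show (0 : ℝ) < 1 / 12 by norm_num)
    filter_upwards [this, hlog.eventually_ge_atTop 0] with n h h0
    simpa [abs_of_nonneg h0] using h
  refine IsBigO.of_bound 36 ?_
  filter_upwards [hsmall, hlog.eventually_ge_atTop 1, eventually_ge_atTop 12] with n h1 h2 h3
  -- Half of the dimensions are reserved for `L`; since `2 ^ k > n`, this `k` suffices for a missed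
  -- pattern.
  set k := Nat.log 2 n + 1 with hk
  set m := n / 2 with hm
  have hkm : m < 2 ^ k := (Nat.div_le_self n 2).trans_lt (Nat.lt_pow_succ_log_self one_lt_two n)
  have hklog : (k : ℝ) ≤ 3 * Real.log n := by
    have hn0 : (0 : ℝ) < n := by positivity
    have hp : (2 : ℝ) ^ Nat.log 2 n ≤ n := by
      exact_mod_cast Nat.pow_log_le_self 2 (by omega)
    have := Real.log_le_log (by positivity) hp
    rw [Real.log_pow] at this
    have h2' := Real.log_two_gt_d9
    have hc : (k : ℝ) = Nat.log 2 n + 1 := by simp [hk]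
    have : (Nat.log 2 n : ℝ) * (1 / 2) ≤ Real.log n := by
      refine le_trans ?_ this
      gcongr
      linarith
    linarith
  have hk4 : 4 * k ≤ n := by
    have : (4 : ℝ) * k ≤ n := by linarith
    exact_mod_cast this
  have hk0 : 0 < k := Nat.succ_pos _
  set R := (n - m - k) / k with hR
  have hRk : R * k ≤ n - m - k := Nat.div_mul_le_self _ _
  have ht := le_toNat_t (n := n) (R := R) hkm hk0 (by omega)
  have hRk' : n - m - k < (R + 1) * k := by
    rw [mul_comm]
    exact Nat.lt_mul_div_succ _ hk0
  -- `m ≤ n / 2` and `k ≤ n / 4` leave at least `n / 4` dimensions for retreats.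
  have hR4 : (n : ℝ) / 4 ≤ (R + 1) * k := by
    have : n ≤ 4 * ((R + 1) * k) := by omega
    have : (n : ℝ) ≤ 4 * ((R + 1) * k) := by exact_mod_cast this
    linarith
  have hm3 : (n : ℝ) / 3 ≤ m := by
    have : n ≤ 3 * m := by omega
    have : (n : ℝ) ≤ 3 * m := by exact_mod_cast this
    linarith
  have ht' : ((R : ℝ) + 1) * m ≤ (t n).toNat := by exact_mod_cast ht
  rw [Real.norm_of_nonneg (by positivity), Real.norm_of_nonneg (by positivity),
    div_le_iff₀ (by linarith)]
  calc (n : ℝ) ^ 2 = 12 * (n / 4 * (n / 3)) := by ring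
    _ ≤ 12 * (((R + 1) * k) * m) := by gcongr
    _ = 12 * (((R + 1) * m) * k) := by ring
    _ ≤ 12 * ((t n).toNat * (3 * Real.log n)) := by gcongr
    _ = 36 * (t n).toNat * Real.log n := by ring

end SinkOrClash

theorem mainTheorem8 :
    (∀ n : ℕ, SinkOrClash.q n ≤ SinkOrClash.t n) ∧
    (∀ n : ℕ, SinkOrClash.qRand n ≤ SinkOrClash.tRand n) ∧
    (fun n : ℕ => (n : ℝ) ^ 2 / Real.log (n : ℝ)) =O[atTop]
      (fun n : ℕ => ((SinkOrClash.t n).toNat : ℝ)) :=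
  ⟨SinkOrClash.q_le_t, SinkOrClash.qRand_le_tRand, SinkOrClash.isBigO_toNat_t⟩
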